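/- For groups $A$, $B$ let $A\wr B$ denote the restricted wreath product, that is, the semidirect product of $A$ and $\sum_A B$, where $\sum_A B$ is the group of functions $f:A\to B$ with $f(x)=e$ for all but finitely many $x\in A$ and $A$ acts on it by shifts of the argument. Define $G_1=\mathbb Z$ and $G_{i+1}=\mathbb Z\wr G_i$ for $i\ge 1$. Then for every $i\ge 1$ there is a probability measure $\mu$ on $G_i$, uniform on a finite symmetric generating set of $G_i$ (a simple random walk), with the following property. For every finite generating set $T$ of $G_i$, with word length $l_T$ (the least length of a word in the elements of $T$ and their inverses), the drift $L_n=\mathbb E_{\mu^{*n}}\,l_T(g)$, where $\mu^{*n}$ is the $n$-th convolution power of $\mu$, satisfies $L_n\asymp n^{1-1/2^i}$, that is, there are constants $c,C>0$ such that $$c\,n^{1-\frac1{2^i}}\le L_n\le C\,n^{1-\frac1{2^i}}\qquad\text{for all } n\ge 0.$$ -/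

import Mathlib

/-- The direct sum `∑_A B` for a possibly non-commutative group `B`: the group, under pointwise
multiplication, of the functions `A → B` that equal `1` outside a finite set. -/
def lampGroup (A B : Type) [Group B] : Subgroup (A → B) where
  carrier := {f | (Function.mulSupport f).Finite}
  one_mem' := by simp
  mul_mem' {f g} hf hg := (hf.union hg).subset (Function.mulSupport_mul f g)
  inv_mem' {f} hf := by simpa using hf

/-- The action of `A` on `∑_A B` by shifts: `a` sends `f` to the function `x ↦ f (a⁻¹ x)`
(for commutative `A`, this is `x ↦ f (x a⁻¹)`). -/
def lampShift (A B : Type) [Group A] [Group B] : A →* MulAut (lampGroup A B) where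
  toFun a :=
    { toFun := fun f => ⟨fun x => f.1 (a⁻¹ * x), by
        have h : (Function.mulSupport f.1).Finite := f.2
        exact h.preimage (mul_right_injective a⁻¹).injOn⟩
      invFun := fun f => ⟨fun x => f.1 (a * x), by
        have h : (Function.mulSupport f.1).Finite := f.2
        exact h.preimage (mul_right_injective a).injOn⟩
      left_inv := fun f => by ext x; simp
      right_inv := fun f => by ext x; simp
      map_mul' := fun f g => by ext x; simp }
  map_one' := by ext f x; simp
  map_mul' a b := by ext f x; simp [mul_assoc]

/-- The (restricted) wreath product `A ≀ B`: base group `A`, lamps with values in `B`. It is the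
semidirect product of `∑_A B` and `A`, where `A` acts by shifts. -/
abbrev Wreath (A B : Type) [Group A] [Group B] : Type :=
  SemidirectProduct (lampGroup A B) A (lampShift A B)

/-- The iterated wreath products `G_1 = ℤ`, `G_{i+1} = ℤ ≀ G_i`, with the index starting from `0`:
`iterWreath k` is the group `G_{k+1}`. -/
noncomputable def iterWreath : ℕ → GrpCat.{0}
  | 0 => GrpCat.of (Multiplicative ℤ)
  | k + 1 => GrpCat.of (Wreath (Multiplicative ℤ) (iterWreath k))

/-- The word length of `g` with respect to `T`: the least length of a word in the elements of `T`
and their inverses that represents `g` (used only for generating sets `T`). -/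
noncomputable def wordLength {G : Type} [Group G] (T : Finset G) (g : G) : ℕ :=
  sInf {k | ∃ w : List G, (∀ x ∈ w, x ∈ T ∨ x⁻¹ ∈ T) ∧ w.prod = g ∧ w.length = k}

/-- The convolution of two probability measures on a group: the law of a product of two
independent elements. -/
noncomputable def PMF.convolution {G : Type} [Group G] (μ ν : PMF G) : PMF G :=
  μ.bind fun g => ν.map fun h => g * h

/-- The `n`-th convolution `μ^{*n}`. -/
noncomputable def PMF.convPow {G : Type} [Group G] (μ : PMF G) : ℕ → PMF G
  | 0 => PMF.pure 1
  | n + 1 => (PMF.convPow μ n).convolution μ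

/-- A random walk is simple if its step distribution is uniform on a finite symmetric
generating set. -/
def IsSimpleWalk {G : Type} [Group G] (μ : PMF G) : Prop :=
  ∃ (S : Finset G) (hS : S.Nonempty), (∀ s ∈ S, s⁻¹ ∈ S) ∧
    Subgroup.closure (S : Set G) = ⊤ ∧ μ = PMF.uniformOfFinset S hS

/-- The drift `L_n = E_{μ^{*n}} l(g)`, where `l` is the word length with respect to `T`. -/
noncomputable def drift {G : Type} [Group G] (T : Finset G) (μ : PMF G) (n : ℕ) : ℝ :=
  ∑' g : G, (μ.convPow n g).toReal * (wordLength T g : ℝ)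

/-- For a finitely supported step distribution the sum that defines the drift has only finitely
many nonzero terms. -/
theorem drift_support_finite {G : Type} [Group G] (T : Finset G) (μ : PMF G)
    (hμ : μ.support.Finite) (n : ℕ) :
    (Function.support fun g => (μ.convPow n g).toReal * (wordLength T g : ℝ)).Finite := by
  have h : (μ.convPow n).support.Finite := by
    induction n with
    | zero => simp [PMF.convPow]
    | succ n ih =>
      simp only [PMF.convPow, PMF.convolution, PMF.support_bind, PMF.support_map]
      exact ih.biUnion fun g _ => hμ.image _
  refine h.subset fun g hg => ?_
  rw [PMF.mem_support_iff]
  intro h0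
  simp [h0] at hg

/-! The exponent comes from one recursion: if some lazy simple walk on `B` has drift of order `n ^
α` with `0 < α < 1`, then a suitable one on `ℤ ≀ B` has drift of order `n ^ ((1 + α) / 2)`. This
halves `1 - α`, which is `1/2` for `ℤ`.

On `ℤ ≀ B` the walk either stays or switches the current lamp, moves to a neighbour and switches the
lamp there. Given the path on `ℤ`, the lamp at `y` has made as many independent steps of the walk on
`B` as the path has departures from and arrivals at `y` (`IntWreath.walkMean_val`). Up to constants,
the word length is at least the sum of the lengths of the lamps, and at most that sum plus the
radius of the path plus 1 (`exists_sum_wordLength_val_le`, `exists_wordLength_le`). Expectation is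
linear, so the joint law of different lamps plays no role, and what remains is the mean of `∑ y,
visits y ^ α`.

In dimension one about `√n` sites are visited about `√n` times each, so this mean has order `√n * √n
^ α`. The upper bound needs the mean radius (Doob's inequality), the lower bound the mean number of
self-intersections (a discrete Tanaka formula). All means are iterates of an averaging operator on
functions, so martingale arguments reduce to one-step inequalities. -/

/-! ### Averaging operators of random walks driven by uniform choices -/

section Mean

variable {X Y Ω : Type*} [Fintype Ω]

/-- The mean of `F` after one step from `x`, the choice `ω` being uniform. -/
noncomputable def stepMean (step : X → Ω → X) (F : X → ℝ) (x : X) : ℝ :=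
  (∑ ω, F (step x ω)) / Fintype.card Ω

/-- The mean of `F` after `n` independent steps from `x`. -/
noncomputable def walkMean (step : X → Ω → X) (n : ℕ) (F : X → ℝ) : X → ℝ :=
  (stepMean step)^[n] F

variable {step : X → Ω → X}

theorem walkMean_zero (F : X → ℝ) (x : X) : walkMean step 0 F x = F x := rfl

theorem walkMean_succ (n : ℕ) (F : X → ℝ) :
    walkMean step (n + 1) F = walkMean step n (stepMean step F) := rfl

theorem walkMean_one (F : X → ℝ) : walkMean step 1 F = stepMean step F := rfl

theorem walkMean_add_steps (m n : ℕ) (F : X → ℝ) :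
    walkMean step (m + n) F = walkMean step m (walkMean step n F) :=
  Function.iterate_add_apply _ m n F

theorem stepMean_add (F G : X → ℝ) :
    stepMean step (fun x => F x + G x) = fun x => stepMean step F x + stepMean step G x := by
  funext x
  simp [stepMean, Finset.sum_add_distrib, add_div]

theorem stepMean_const_mul (c : ℝ) (F : X → ℝ) :
    stepMean step (fun x => c * F x) = fun x => c * stepMean step F x := by
  funext x
  simp [stepMean, ← Finset.mul_sum, mul_div_assoc]

theorem stepMean_const [Nonempty Ω] (c : ℝ) : stepMean step (fun _ => c) = fun _ => c := by
  funext x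
  simp [stepMean]

theorem walkMean_add (n : ℕ) (F G : X → ℝ) (x : X) :
    walkMean step n (fun x => F x + G x) x = walkMean step n F x + walkMean step n G x := by
  induction n generalizing F G with
  | zero => rfl
  | succ n ih => rw [walkMean_succ, stepMean_add, ih]; rfl

theorem walkMean_const_mul (n : ℕ) (c : ℝ) (F : X → ℝ) (x : X) :
    walkMean step n (fun x => c * F x) x = c * walkMean step n F x := by
  induction n generalizing F with
  | zero => rfl
  | succ n ih => rw [walkMean_succ, stepMean_const_mul, ih]; rfl

theorem walkMean_const [Nonempty Ω] (n : ℕ) (c : ℝ) (x : X) :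
    walkMean step n (fun _ => c) x = c := by
  induction n with
  | zero => rfl
  | succ n ih => rw [walkMean_succ, stepMean_const, ih]

theorem walkMean_sum {ι : Type*} (n : ℕ) (s : Finset ι) (F : ι → X → ℝ) (x : X) [Nonempty Ω] :
    walkMean step n (fun x => ∑ i ∈ s, F i x) x = ∑ i ∈ s, walkMean step n (F i) x := by
  classical
  induction s using Finset.induction_on with
  | empty => simp [walkMean_const]
  | insert i s hi ih => simp only [Finset.sum_insert hi, walkMean_add, ih]

/-- Monotonicity along a time-dependent invariant of the walk. -/
theorem walkMean_le_of_invariant {Inv : ℕ → X → Prop}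
    (hstep : ∀ k x ω, Inv k x → Inv (k + 1) (step x ω)) (n : ℕ) {F G : X → ℝ} {x : X}
    (h0 : Inv 0 x) (h : ∀ z, Inv n z → F z ≤ G z) :
    walkMean step n F x ≤ walkMean step n G x := by
  induction n generalizing F G with
  | zero => exact h x h0
  | succ n ih =>
    refine ih fun z hz => ?_
    unfold stepMean
    gcongr with ω
    exact h _ (hstep n z ω hz)

theorem walkMean_mono (n : ℕ) {F G : X → ℝ} (h : ∀ z, F z ≤ G z) (x : X) :
    walkMean step n F x ≤ walkMean step n G x :=
  walkMean_le_of_invariant (Inv := fun _ _ => True) (fun _ _ _ _ => trivial) n trivial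
    fun z _ => h z

/-- Lumping: a projection that turns the walk into a walk driven by the same choices transports
means. It links the walks on the group, on histories and on a single lamp. -/
theorem walkMean_map {step' : Y → Ω → Y} {π : X → Y}
    (hπ : ∀ x ω, π (step x ω) = step' (π x) ω) (n : ℕ) (F : Y → ℝ) (x : X) :
    walkMean step n (fun x => F (π x)) x = walkMean step' n F (π x) := by
  induction n generalizing F with
  | zero => rfl
  | succ n ih =>
    rw [walkMean_succ, walkMean_succ, ← ih]
    congr 1
    funext z
    simp [stepMean, hπ]

/-- With `c = 0` this is the supermartingale inequality. -/
theorem walkMean_le_of_stepMean_le [Nonempty Ω] {F : X → ℝ} {c : ℝ}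
    (h : ∀ x, stepMean step F x ≤ F x + c) (n : ℕ) (x : X) :
    walkMean step n F x ≤ F x + n * c := by
  induction n with
  | zero => simp [walkMean_zero]
  | succ n ih =>
    have := walkMean_mono (step := step) n h x
    rw [walkMean_add, walkMean_const] at this
    rw [walkMean_succ]
    push_cast
    linarith

theorem walkMean_eq_of_stepMean_eq [Nonempty Ω] {F : X → ℝ} {c : ℝ}
    (h : ∀ x, stepMean step F x = F x + c) (n : ℕ) (x : X) :
    walkMean step n F x = F x + n * c := by
  induction n with
  | zero => simp [walkMean_zero]
  | succ n ih =>
    have h' : stepMean step F = fun x => F x + c := funext h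
    rw [walkMean_succ, h', walkMean_add, walkMean_const, ih]
    push_cast
    ring

end Mean

/-! ### The drift as a mean -/

section Drift

variable {G : Type} [Group G]

theorem convolution_uniformOfFinset_apply (ν : PMF G) {S : Finset G} (hS : S.Nonempty) (g : G) :
    ν.convolution (PMF.uniformOfFinset S hS) g = ∑ s ∈ S, (S.card : ENNReal)⁻¹ * ν (g * s⁻¹) := by
  classical
  simp only [PMF.convolution, PMF.bind_apply, PMF.map_apply, PMF.uniformOfFinset_apply]
  have h1 : ∀ a : G, (∑' b : G, if g = a * b then (if b ∈ S then (S.card : ENNReal)⁻¹ else 0) else 0)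
      = ∑ s ∈ S, if a = g * s⁻¹ then (S.card : ENNReal)⁻¹ else 0 := by
    intro a
    rw [tsum_eq_sum (s := S)]
    · refine Finset.sum_congr rfl fun s hs => ?_
      simp [hs, eq_mul_inv_iff_mul_eq, eq_comm]
    · intro b hb
      simp [hb]
  simp only [h1, Finset.mul_sum]
  rw [Summable.tsum_finsetSum fun _ _ => ENNReal.summable]
  refine Finset.sum_congr rfl fun s _ => ?_
  rw [tsum_eq_single (g * s⁻¹)]
  · simp [mul_comm]
  · intro b hb
    simp [hb]

variable {Ω : Type} [Fintype Ω] {S : Finset G} (e : Ω → G)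

/-- The last factor of the convolution is absorbed into `F`, so the induction runs over all `F`.
Injectivity of `e` makes the uniform measure on `S` the law of `e ω` for uniform `ω`. -/
theorem hasSum_convPow_mul (he : Function.Injective e) (hS : S.Nonempty)
    (hSe : (S : Set G) = Set.range e) (n : ℕ) (F : G → ℝ) :
    HasSum (fun g => ((PMF.uniformOfFinset S hS).convPow n g).toReal * F g)
      (walkMean (fun g ω => g * e ω) n F 1) := by
  classical
  have hS' : S = Finset.univ.image e := by
    apply Finset.coe_injective
    simp [hSe]
  have hcard : S.card = Fintype.card Ω := by
    rw [hS', Finset.card_image_of_injective _ he, Finset.card_univ]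
  induction n generalizing F with
  | zero =>
    have h : (fun g => ((PMF.uniformOfFinset S hS).convPow 0 g).toReal * F g) =
        fun g => if g = 1 then F 1 else 0 := by
      funext g
      simp only [PMF.convPow, PMF.pure_apply]
      split_ifs with h <;> simp [h]
    rw [h]
    exact hasSum_ite_eq (1 : G) (F 1)
  | succ n ih =>
    rw [walkMean_succ]
    set ν := (PMF.uniformOfFinset S hS).convPow n with hν
    have key : ∀ ω, HasSum (fun g => (ν (g * (e ω)⁻¹)).toReal * F g)
        (walkMean (fun g ω => g * e ω) n (fun g => F (g * e ω)) 1) := by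
      intro ω
      have := ih (fun g => F (g * e ω))
      rw [← (Equiv.mulRight (e ω)).hasSum_iff]
      convert this using 2 with g
      simp
    have h2 := (hasSum_sum (s := Finset.univ) fun ω _ => key ω).div_const (Fintype.card Ω : ℝ)
    have : Nonempty Ω := by
      obtain ⟨s, hs⟩ := hS
      have : s ∈ Set.range e := by rw [← hSe]; exact hs
      exact ⟨this.choose⟩
    rw [← walkMean_sum] at h2
    have h3 : (fun g => ((PMF.uniformOfFinset S hS).convPow (n + 1) g).toReal * F g) =
        fun g => (∑ ω, (ν (g * (e ω)⁻¹)).toReal * F g) / (Fintype.card Ω : ℝ) := by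
      funext g
      simp only [PMF.convPow, ← hν]
      rw [convolution_uniformOfFinset_apply, ENNReal.toReal_sum, hcard, Finset.sum_mul,
        Finset.sum_div, hS', Finset.sum_image (fun _ _ _ _ h => he h)]
      · refine Finset.sum_congr rfl fun ω _ => ?_
        simp only [ENNReal.toReal_mul, ENNReal.toReal_inv, ENNReal.toReal_natCast]
        ring
      · intro s _
        exact ENNReal.mul_ne_top (by simp [hS.card_pos.ne']) (PMF.apply_ne_top _ _)
    have h4 : stepMean (fun g ω => g * e ω) F
        = fun g => (Fintype.card Ω : ℝ)⁻¹ * ∑ ω, F (g * e ω) := by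
      funext g
      simp [stepMean, div_eq_inv_mul]
    rw [h3, h4, walkMean_const_mul, ← div_eq_inv_mul]
    exact h2

theorem drift_uniformOfFinset (he : Function.Injective e) (hS : S.Nonempty)
    (hSe : (S : Set G) = Set.range e) (T : Finset G) (n : ℕ) :
    drift T (PMF.uniformOfFinset S hS) n =
      walkMean (fun g ω => g * e ω) n (fun g => (wordLength T g : ℝ)) 1 :=
  (hasSum_convPow_mul e he hS hSe n _).tsum_eq

end Drift

/-! ### Word lengths -/

section WordLength

variable {G : Type} [Group G] {T : Finset G}

theorem exists_word (hT : Subgroup.closure (T : Set G) = ⊤) (g : G) :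
    ∃ w : List G, (∀ x ∈ w, x ∈ T ∨ x⁻¹ ∈ T) ∧ w.prod = g ∧ w.length = wordLength T g := by
  have hg : g ∈ Subgroup.closure (T : Set G) := hT ▸ Subgroup.mem_top g
  rw [← Subgroup.mem_toSubmonoid, Subgroup.closure_toSubmonoid] at hg
  obtain ⟨w, hw, hp⟩ := Submonoid.exists_list_of_mem_closure hg
  exact Nat.sInf_mem (s := {k | ∃ w : List G, (∀ x ∈ w, x ∈ T ∨ x⁻¹ ∈ T) ∧ w.prod = g ∧
    w.length = k}) ⟨w.length, w, hw, hp, rfl⟩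

theorem wordLength_prod_le {w : List G} (hw : ∀ x ∈ w, x ∈ T ∨ x⁻¹ ∈ T) :
    wordLength T w.prod ≤ w.length :=
  Nat.sInf_le ⟨w, hw, rfl, rfl⟩

theorem wordLength_one : wordLength T (1 : G) = 0 :=
  Nat.le_zero.mp (wordLength_prod_le (w := []) (by simp))

theorem wordLength_mul_le (hT : Subgroup.closure (T : Set G) = ⊤) (g h : G) :
    wordLength T (g * h) ≤ wordLength T g + wordLength T h := by
  obtain ⟨v, hv, rfl, hvl⟩ := exists_word hT g
  obtain ⟨w, hw, rfl, hwl⟩ := exists_word hT h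
  rw [← hvl, ← hwl, ← List.prod_append, ← List.length_append]
  apply wordLength_prod_le
  intro x hx
  rcases List.mem_append.mp hx with hx | hx
  exacts [hv x hx, hw x hx]

theorem wordLength_inv_le (hT : Subgroup.closure (T : Set G) = ⊤) (g : G) :
    wordLength T g⁻¹ ≤ wordLength T g := by
  obtain ⟨v, hv, rfl, hvl⟩ := exists_word hT g
  rw [← hvl, List.prod_inv_reverse]
  refine (wordLength_prod_le ?_).trans (by simp)
  intro x hx
  simp only [List.mem_reverse, List.mem_map] at hx
  obtain ⟨y, hy, rfl⟩ := hx
  simpa [or_comm] using hv y hy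

theorem wordLength_zpow_le (hT : Subgroup.closure (T : Set G) = ⊤) (g : G) (j : ℤ) :
    wordLength T (g ^ j) ≤ j.natAbs * wordLength T g := by
  have hnat : ∀ n : ℕ, wordLength T (g ^ n) ≤ n * wordLength T g := by
    intro n
    induction n with
    | zero => simp [wordLength_one]
    | succ n ih =>
      rw [pow_succ]
      have := wordLength_mul_le hT (g ^ n) g
      linarith
  rcases Int.eq_nat_or_neg j with ⟨n, rfl | rfl⟩
  · simpa using hnat n
  · rw [zpow_neg, zpow_natCast, Int.natAbs_neg, Int.natAbs_natCast]
    exact (wordLength_inv_le hT _).trans (hnat n)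

/-- A symmetric subadditive function is at most a multiple of the word length. -/
theorem exists_le_mul_wordLength (hT : Subgroup.closure (T : Set G) = ⊤) (Λ : G → ℝ)
    (h1 : Λ 1 ≤ 0) (hmul : ∀ g h, Λ (g * h) ≤ Λ g + Λ h) (hinv : ∀ g, Λ g⁻¹ ≤ Λ g) :
    ∃ K : ℝ, 0 < K ∧ ∀ g, Λ g ≤ K * wordLength T g := by
  refine ⟨∑ t ∈ T, |Λ t| + 1, by positivity, fun g => ?_⟩
  obtain ⟨w, hw, rfl, hl⟩ := exists_word hT g
  rw [← hl]
  clear hl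
  have hgen : ∀ x, x ∈ T → Λ x ≤ ∑ t ∈ T, |Λ t| + 1 := fun x hx => by
    have := Finset.single_le_sum (f := fun t => |Λ t|) (fun t _ => abs_nonneg _) hx
    have := le_abs_self (Λ x)
    linarith
  induction w with
  | nil => simpa using h1
  | cons x w ih =>
    have hx : Λ x ≤ ∑ t ∈ T, |Λ t| + 1 := by
      rcases hw x (by simp) with hx | hx
      · exact hgen x hx
      · have := hinv x⁻¹
        rw [inv_inv] at this
        exact this.trans (hgen _ hx)
    have := ih fun y hy => hw y (by simp [hy])
    have := hmul x w.prod
    simp only [List.prod_cons, List.length_cons]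
    push_cast
    linarith

end WordLength

/-! ### The lazy simple random walk on `ℤ` and its local times -/

section Trace

/-- The choices of a lazy walk on `ℤ` that carries two labels: stay (`none`), or move to the right
(`true`) or to the left (`false`). -/
abbrev Move (σ : Type) : Type := Option (Bool × σ × σ)

/-- The increment that belongs to a direction. -/
def dirStep (ε : Bool) : ℤ := if ε then 1 else -1

/-- The history of a walk on `ℤ`: the position, the lists of the points of departure and of arrival
of the steps, and the largest distance from the origin so far. -/
structure Trace where
  pos : ℤ
  dep : List ℤ
  arr : List ℤ
  rad : ℕ

namespace Trace

/-- The empty history at the origin. -/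
def start : Trace := ⟨0, [], [], 0⟩

/-- A step in the direction `ε`. -/
def go (h : Trace) (ε : Bool) : Trace where
  pos := h.pos + dirStep ε
  dep := h.pos :: h.dep
  arr := (h.pos + dirStep ε) :: h.arr
  rad := max h.rad (h.pos + dirStep ε).natAbs

variable {σ : Type}

/-- The lazy walk on histories. -/
def step (h : Trace) : Move σ → Trace
  | none => h
  | some (ε, _, _) => h.go ε

/-- The number of departures from and arrivals at `y`. -/
def visits (h : Trace) (y : ℤ) : ℕ := h.dep.count y + h.arr.count y

/-- Bounds that hold after `n` steps. -/
structure Bounded (n : ℕ) (h : Trace) : Prop where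
  pos_le : h.pos.natAbs ≤ h.rad
  dep_le : ∀ a ∈ h.dep, a.natAbs ≤ h.rad
  arr_le : ∀ a ∈ h.arr, a.natAbs ≤ h.rad
  length_dep : h.dep.length ≤ n
  length_arr : h.arr.length ≤ n
  rad_le : h.rad ≤ n

theorem bounded_start : Bounded 0 start := by
  constructor <;> simp [start]

theorem Bounded.step {n : ℕ} {h : Trace} (hb : Bounded n h) (ω : Move σ) :
    Bounded (n + 1) (h.step ω) := by
  obtain ⟨h1, h2, h3, h4, h5, h6⟩ := hb
  rcases ω with _ | ⟨ε, s, s'⟩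
  · exact ⟨h1, h2, h3, by simp [Trace.step]; omega, by simp [Trace.step]; omega,
      by simp [Trace.step]; omega⟩
  · have hd : (dirStep ε).natAbs = 1 := by cases ε <;> rfl
    refine ⟨?_, ?_, ?_, ?_, ?_, ?_⟩ <;> simp only [Trace.step, go]
    · exact le_max_right _ _
    · intro a ha
      rcases List.mem_cons.mp ha with rfl | ha
      · exact h1.trans (le_max_left _ _)
      · exact (h2 a ha).trans (le_max_left _ _)
    · intro a ha
      rcases List.mem_cons.mp ha with rfl | ha
      · exact le_max_right _ _
      · exact (h3 a ha).trans (le_max_left _ _)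
    · simpa using h4
    · simpa using h5
    · have := Int.natAbs_add_le h.pos (dirStep ε)
      omega

end Trace

variable (σ : Type) [Fintype σ]

/-- The probability that the lazy walk moves. -/
noncomputable def moveProb : ℝ := 2 * (Fintype.card σ : ℝ) ^ 2 / (2 * (Fintype.card σ : ℝ) ^ 2 + 1)

theorem moveProb_pos [Nonempty σ] : 0 < moveProb σ := by
  have : 0 < (Fintype.card σ : ℝ) := by exact_mod_cast Fintype.card_pos
  unfold moveProb
  positivity

theorem moveProb_le_one : moveProb σ ≤ 1 := by
  unfold moveProb
  rw [div_le_one (by positivity)]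
  linarith

theorem card_move : (Fintype.card (Move σ) : ℝ) = 2 * (Fintype.card σ : ℝ) ^ 2 + 1 := by
  simp
  ring

variable {σ}

/-- The labels average out: of `2 * |σ| ^ 2 + 1` equally likely choices one stays, and each
direction has `|σ| ^ 2`. -/
theorem stepMean_move {X : Type*} {step : X → Move σ → X} {go : X → Bool → X} {F : X → ℝ} {x : X}
    (h0 : F (step x none) = F x) (h1 : ∀ ε s s', F (step x (some (ε, s, s'))) = F (go x ε)) :
    stepMean step F x =
      (1 - moveProb σ) * F x + moveProb σ * ((F (go x true) + F (go x false)) / 2) := by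
  have hc : (2 * (Fintype.card σ : ℝ) ^ 2 + 1) ≠ 0 := by positivity
  unfold stepMean moveProb
  rw [card_move, Fintype.sum_option, h0, Fintype.sum_prod_type]
  simp only [h1, Fintype.sum_bool, Finset.sum_const, Finset.card_univ, Fintype.card_prod,
    nsmul_eq_mul]
  push_cast
  field_simp
  ring

namespace Trace

theorem stepMean_eq (F : Trace → ℝ) (h : Trace) :
    stepMean (step (σ := σ)) F h =
      (1 - moveProb σ) * F h + moveProb σ * ((F (h.go true) + F (h.go false)) / 2) :=
  stepMean_move rfl fun _ _ _ => rfl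

/-! ### Moments of the position, the maximal distance and the self-intersections. -/

theorem mean_pos_sq (n : ℕ) :
    walkMean (step (σ := σ)) n (fun h => (h.pos : ℝ) ^ 2) start = n * moveProb σ := by
  rw [walkMean_eq_of_stepMean_eq (c := moveProb σ)]
  · simp [start]
  · intro h
    rw [stepMean_eq]
    simp [go, dirStep]
    ring

theorem mean_pos_pow_four_le (n : ℕ) :
    walkMean (step (σ := σ)) n (fun h => (h.pos : ℝ) ^ 4) start ≤ 7 * (n : ℝ) ^ 2 := by
  have hq := moveProb_le_one σ
  have hq0 : 0 ≤ moveProb σ := by unfold moveProb; positivity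
  induction n with
  | zero => simp [walkMean_zero, start]
  | succ n ih =>
    have h1 : stepMean (step (σ := σ)) (fun h => (h.pos : ℝ) ^ 4) =
        fun h => (h.pos : ℝ) ^ 4 + (moveProb σ * 6 * (h.pos : ℝ) ^ 2 + moveProb σ) := by
      funext h
      rw [stepMean_eq]
      simp [go, dirStep]
      ring
    rw [walkMean_succ, h1, walkMean_add, walkMean_add, walkMean_const_mul, walkMean_const,
      mean_pos_sq]
    have : moveProb σ * 6 * (n * moveProb σ) ≤ 6 * n := by
      have : moveProb σ * moveProb σ ≤ 1 := by nlinarith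
      have : (0 : ℝ) ≤ n := by positivity
      nlinarith
    push_cast
    nlinarith

/-- Doob's maximal inequality in `L²`. -/
theorem mean_rad_sq_le (n : ℕ) :
    walkMean (step (σ := σ)) n (fun h => (h.rad : ℝ) ^ 2) start ≤ 4 * n := by
  have hq := moveProb_le_one σ
  have hq0 : 0 ≤ moveProb σ := by unfold moveProb; positivity
  -- A supermartingale: raising `rad` to the new value of `|pos|` can only decrease the expression,
  -- and for fixed `rad` the submartingale `|pos|` enters with a negative sign.
  have h1 : walkMean (step (σ := σ)) n
      (fun h => (h.rad : ℝ) ^ 2 / 2 - h.rad * |(h.pos : ℝ)|) start ≤ 0 := by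
    refine (walkMean_le_of_stepMean_le (c := 0) ?_ n start).trans (by simp [start])
    intro h
    rw [stepMean_eq]
    have key : ∀ ε, ((h.go ε).rad : ℝ) ^ 2 / 2 - (h.go ε).rad * |((h.go ε).pos : ℝ)| ≤
        (h.rad : ℝ) ^ 2 / 2 - h.rad * |((h.pos + dirStep ε : ℤ) : ℝ)| := by
      intro ε
      have : ((h.go ε).rad : ℝ) = max (h.rad : ℝ) |((h.pos + dirStep ε : ℤ) : ℝ)| := by
        simp only [go]
        rw [Nat.cast_max, Nat.cast_natAbs, Int.cast_abs]
      rw [this]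
      simp only [go]
      rcases le_total (h.rad : ℝ) |((h.pos + dirStep ε : ℤ) : ℝ)| with hle | hle
      · rw [max_eq_right hle]
        nlinarith [sq_nonneg ((h.rad : ℝ) - |((h.pos + dirStep ε : ℤ) : ℝ)|)]
      · rw [max_eq_left hle]
    have kt := key true
    have kf := key false
    have habs : 2 * |(h.pos : ℝ)| ≤ |((h.pos + dirStep true : ℤ) : ℝ)| +
        |((h.pos + dirStep false : ℤ) : ℝ)| := by
      have := abs_add_le ((h.pos + dirStep true : ℤ) : ℝ) ((h.pos + dirStep false : ℤ) : ℝ)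
      have h2 : ((h.pos + dirStep true : ℤ) : ℝ) + ((h.pos + dirStep false : ℤ) : ℝ) =
          2 * (h.pos : ℝ) := by
        simp [dirStep]; ring
      rw [h2, abs_mul, abs_two] at this
      exact this
    have hr : (0 : ℝ) ≤ h.rad := by positivity
    have hm := mul_le_mul_of_nonneg_left habs hr
    have hs : ∀ a b c : ℝ, a + b ≤ 2 * c →
        (1 - moveProb σ) * c + moveProb σ * ((a + b) / 2) ≤ c + 0 := by
      intro a b c hab
      nlinarith
    apply hs
    linarith
  have h2 : walkMean (step (σ := σ)) n (fun h => (h.rad : ℝ) ^ 2) start ≤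
      walkMean (step (σ := σ)) n (fun h => 4 * (((h.rad : ℝ) ^ 2 / 2 - h.rad * |(h.pos : ℝ)|) +
        (h.pos : ℝ) ^ 2)) start := by
    -- The difference of the two sides is the square `(rad - 2 * |pos|) ^ 2`.
    refine walkMean_mono n (fun h => ?_) _
    rw [← sq_abs (h.pos : ℝ)]
    nlinarith [sq_nonneg ((h.rad : ℝ) - 2 * |(h.pos : ℝ)|)]
  rw [walkMean_const_mul, walkMean_add, mean_pos_sq] at h2
  have : n * moveProb σ ≤ n := mul_le_of_le_one_right (by positivity) hq
  linarith

theorem mean_rad_le {n : ℕ} (hn : 0 < n) :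
    walkMean (step (σ := σ)) n (fun h => (h.rad : ℝ)) start ≤ 5 / 2 * √n := by
  have hs : 0 < √(n : ℝ) := by positivity
  have h1 : walkMean (step (σ := σ)) n (fun h => (h.rad : ℝ)) start ≤
      walkMean (step (σ := σ)) n (fun h => 1 / (2 * √n) * (h.rad : ℝ) ^ 2 + √n / 2) start := by
    refine walkMean_mono n (fun h => ?_) _
    have : 1 / (2 * √n) * (h.rad : ℝ) ^ 2 + √n / 2 - h.rad =
        1 / (2 * √n) * ((h.rad : ℝ) - √n) ^ 2 := by
      field_simp
      ring
    have : 0 ≤ 1 / (2 * √n) * ((h.rad : ℝ) - √n) ^ 2 := by positivity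
    linarith
  rw [walkMean_add, walkMean_const_mul, walkMean_const] at h1
  have h2 : 1 / (2 * √n) * walkMean (step (σ := σ)) n (fun h => (h.rad : ℝ) ^ 2) start ≤
      1 / (2 * √n) * (4 * n) :=
    mul_le_mul_of_nonneg_left (mean_rad_sq_le n) (by positivity)
  have h3 : 1 / (2 * √n) * (4 * (n : ℝ)) = 2 * √n := by
    field_simp
    rw [Real.sq_sqrt (by positivity)]
    ring
  linarith

/-- The number of pairs of equal entries of a list. -/
def _root_.List.coincidences : List ℤ → ℕ
  | [] => 0
  | a :: l => List.coincidences l + 2 * l.count a + 1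

/-- A new entry raises one multiplicity from `m` to `m + 1`, hence its square by `2 * m + 1`. -/
theorem _root_.List.sum_count_sq_le (Y : Finset ℤ) (l : List ℤ) :
    ∑ y ∈ Y, l.count y ^ 2 ≤ l.coincidences := by
  induction l with
  | nil => simp [List.coincidences]
  | cons a l ih =>
    have h : ∀ y, (a :: l).count y ^ 2 = l.count y ^ 2 + if a = y then 2 * l.count a + 1 else 0 := by
      intro y
      rw [List.count_cons]
      by_cases hy : a = y
      · simp [hy]; ring
      · simp [hy]
    simp only [h, Finset.sum_add_distrib, Finset.sum_ite_eq, List.coincidences]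
    split_ifs <;> omega

theorem _root_.List.sum_count_eq (Y : Finset ℤ) (l : List ℤ) (hl : ∀ a ∈ l, a ∈ Y) :
    ∑ y ∈ Y, l.count y = l.length := by
  induction l with
  | nil => simp
  | cons a l ih =>
    simp only [List.count_cons, Finset.sum_add_distrib, List.length_cons]
    rw [ih fun b hb => hl b (by simp [hb])]
    simp [hl a (by simp)]

/-- The sum of the distances of the entries of a list from a point. -/
def distSum (l : List ℤ) (x : ℤ) : ℤ := (l.map fun a => |x - a|).sum

/-- The discrete Laplacian of `|x - a|` is `2` at `x = a` and `0` elsewhere; this is the discrete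
Tanaka formula. -/
theorem distSum_add_distSum (l : List ℤ) (x : ℤ) :
    distSum l (x + 1) + distSum l (x - 1) = 2 * distSum l x + 2 * l.count x := by
  induction l with
  | nil => simp [distSum]
  | cons a l ih =>
    simp only [distSum, List.map_cons, List.sum_cons, List.count_cons] at ih ⊢
    have : |x + 1 - a| + |x - 1 - a| = 2 * |x - a| + 2 * if a = x then 1 else 0 := by
      split_ifs with h
      · subst h; simp
      · rcases lt_or_gt_of_ne h with h | h
        · rw [abs_of_nonneg, abs_of_nonneg, abs_of_nonneg] <;> omega
        · rw [abs_of_nonpos, abs_of_nonpos, abs_of_nonpos] <;> omega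
    by_cases h : a = x
    · simp [h] at this ⊢; omega
    · simp [h] at this ⊢; omega

theorem distSum_le {l : List ℤ} {x : ℤ} {r : ℕ} (hx : x.natAbs ≤ r) (hl : ∀ a ∈ l, a.natAbs ≤ r) :
    distSum l x ≤ l.length * (2 * r) := by
  induction l with
  | nil => simp [distSum]
  | cons a l ih =>
    have h1 := ih fun b hb => hl b (by simp [hb])
    have h2 := hl a (by simp)
    have h3 : |x - a| ≤ 2 * r := by rw [abs_le]; omega
    simp only [distSum, List.map_cons, List.sum_cons, List.length_cons] at h1 ⊢
    push_cast
    linarith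

/-- By the Tanaka formula each move raises `2 * distSum` on average by at least as much as
`coincidences`. Hence the mean of `coincidences` is at most that of `2 * distSum`, which is at most
`4 * n * rad`. -/
theorem mean_coincidences_le {n : ℕ} (hn : 0 < n) :
    walkMean (step (σ := σ)) n (fun h => (h.dep.coincidences : ℝ)) start ≤ 10 * n * √n := by
  have hq := moveProb_le_one σ
  have hq0 : 0 ≤ moveProb σ := by unfold moveProb; positivity
  have h1 : walkMean (step (σ := σ)) n
      (fun h => (h.dep.coincidences : ℝ) + (-2) * (distSum h.dep h.pos : ℝ)) start ≤ 0 := by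
    refine (walkMean_le_of_stepMean_le (c := 0) ?_ n start).trans
      (by simp [start, distSum, List.coincidences])
    intro h
    rw [stepMean_eq]
    have h2 := distSum_add_distSum h.dep h.pos
    have h3 : ∀ ε, distSum (h.go ε).dep (h.go ε).pos = 1 + distSum h.dep (h.pos + dirStep ε) := by
      intro ε
      cases ε <;> simp [go, distSum, dirStep]
    have h4 : ∀ ε, ((h.go ε).dep.coincidences : ℝ) =
        h.dep.coincidences + 2 * h.dep.count h.pos + 1 := by
      intro ε
      simp [go, List.coincidences]
    have h5 : (distSum h.dep (h.pos + 1) : ℝ) + distSum h.dep (h.pos - 1) =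
        2 * distSum h.dep h.pos + 2 * h.dep.count h.pos := by exact_mod_cast h2
    simp only [h3, h4, dirStep]
    push_cast
    simp only [← sub_eq_add_neg]
    nlinarith
  rw [walkMean_add, walkMean_const_mul] at h1
  have h2 : walkMean (step (σ := σ)) n (fun h => (distSum h.dep h.pos : ℝ)) start ≤
      walkMean (step (σ := σ)) n (fun h => (2 * n : ℝ) * h.rad) start := by
    refine walkMean_le_of_invariant (Inv := Bounded) (fun k z ω hz => hz.step ω) n
      bounded_start fun h hb => ?_
    have h3 : (distSum h.dep h.pos : ℝ) ≤ h.dep.length * (2 * h.rad) := by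
      exact_mod_cast distSum_le hb.pos_le hb.dep_le
    have h4 : (h.dep.length : ℝ) ≤ n := by exact_mod_cast hb.length_dep
    have : (h.dep.length : ℝ) * (2 * h.rad) ≤ n * (2 * h.rad) := by gcongr
    linarith
  rw [walkMean_const_mul] at h2
  have h3 := mul_le_mul_of_nonneg_left (mean_rad_le (σ := σ) hn) (by positivity : (0 : ℝ) ≤ 2 * n)
  linarith

theorem mean_length_dep (n : ℕ) :
    walkMean (step (σ := σ)) n (fun h => (h.dep.length : ℝ)) start = n * moveProb σ := by
  rw [walkMean_eq_of_stepMean_eq (c := moveProb σ)]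
  · simp [start]
  · intro h
    rw [stepMean_eq]
    simp [go]
    ring

/-! ### Sums of powers of local times. -/

theorem sub_sq_le_rpow {u α : ℝ} (hu : 0 ≤ u) (hα : α ≤ 1) : u - u ^ 2 ≤ u ^ α := by
  rcases hu.eq_or_lt with rfl | hu
  · simpa using Real.rpow_nonneg le_rfl α
  rcases le_total u 1 with h | h
  · have : u ^ (1 : ℝ) ≤ u ^ α := Real.rpow_le_rpow_of_exponent_ge hu h hα
    rw [Real.rpow_one] at this
    nlinarith
  · have : 0 ≤ u ^ α := Real.rpow_nonneg hu.le α
    nlinarith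

theorem rpow_le_one_add {u α : ℝ} (hu : 0 ≤ u) (hα0 : 0 ≤ α) (hα : α ≤ 1) : u ^ α ≤ 1 + u := by
  rcases le_total u 1 with h | h
  · linarith [Real.rpow_le_one hu h hα0]
  · have : u ^ α ≤ u ^ (1 : ℝ) := Real.rpow_le_rpow_of_exponent_le h hα
    rw [Real.rpow_one] at this
    linarith

/-- The sum over `[-n, n]` of the mean of the power `α` of the local time, from below. -/
theorem exists_le_sum_mean_visits_rpow [Nonempty σ] {α : ℝ} (hα0 : 0 < α) (hα : α < 1) :
    ∃ c : ℝ, 0 < c ∧ ∀ n : ℕ, 0 < n → c * (n : ℝ) ^ ((1 + α) / 2) ≤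
      ∑ y ∈ Finset.Icc (-n : ℤ) n,
        walkMean (step (σ := σ)) n (fun h => (h.visits y : ℝ) ^ α) start := by
  set q := moveProb σ with hqdef
  have hq : 0 < q := moveProb_pos σ
  -- With `l = A * √n` the self-intersection term `10 * n * √n / l` is exactly half of the mean
  -- number `n * q` of moves.
  set A := 20 / q with hA
  have hApos : 0 < A := by positivity
  refine ⟨A ^ (α - 1) * (q / 2), by positivity, fun n hn => ?_⟩
  have hn' : (0 : ℝ) < n := by exact_mod_cast hn
  have hs : 0 < √(n : ℝ) := by positivity
  set l := A * √n with hl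
  have hlpos : 0 < l := by positivity
  rw [← walkMean_sum]
  have h1 : walkMean (step (σ := σ)) n (fun h => l ^ (α - 1) * ((h.dep.length : ℝ) +
      (-1 / l) * h.dep.coincidences)) start ≤
      walkMean (step (σ := σ)) n (fun h => ∑ y ∈ Finset.Icc (-n : ℤ) n, (h.visits y : ℝ) ^ α)
        start := by
    refine walkMean_le_of_invariant (Inv := Bounded) (fun k z ω hz => hz.step ω) n
      bounded_start fun h hb => ?_
    -- This is `u - u ^ 2 ≤ u ^ α` at `u = count / l`, multiplied by `l ^ α`: first and second
    -- moments of the local time bound its power from below. Counting departures suffices.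
    have h2 : ∀ y, l ^ (α - 1) * ((h.dep.count y : ℝ) + (-1 / l) * (h.dep.count y : ℝ) ^ 2) ≤
        (h.visits y : ℝ) ^ α := by
      intro y
      have h3 : (h.dep.count y : ℝ) ^ α ≤ (h.visits y : ℝ) ^ α := by
        apply Real.rpow_le_rpow (by positivity) _ hα0.le
        simp [visits]
      refine le_trans ?_ h3
      have h4 := sub_sq_le_rpow (u := (h.dep.count y : ℝ) / l) (by positivity) hα.le
      rw [Real.div_rpow (by positivity) hlpos.le, le_div_iff₀ (by positivity)] at h4
      refine le_trans (le_of_eq ?_) h4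
      rw [Real.rpow_sub_one hlpos.ne']
      field_simp
      ring
    refine le_trans ?_ (Finset.sum_le_sum fun y _ => h2 y)
    rw [← Finset.mul_sum, Finset.sum_add_distrib, ← Finset.mul_sum]
    have h5 : ∑ y ∈ Finset.Icc (-n : ℤ) n, (h.dep.count y : ℝ) = h.dep.length := by
      exact_mod_cast List.sum_count_eq _ _ fun a ha => by
        have := hb.dep_le a ha
        have := hb.rad_le
        rw [Finset.mem_Icc]
        omega
    have h6 : ∑ y ∈ Finset.Icc (-n : ℤ) n, (h.dep.count y : ℝ) ^ 2 ≤ h.dep.coincidences := by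
      exact_mod_cast List.sum_count_sq_le _ _
    rw [h5]
    refine mul_le_mul_of_nonneg_left ?_ (by positivity)
    have : -1 / l ≤ 0 := by
      rw [neg_div]
      have : 0 < 1 / l := by positivity
      linarith
    nlinarith
  refine le_trans ?_ h1
  rw [walkMean_const_mul, walkMean_add, walkMean_const_mul, mean_length_dep]
  have h7 := mean_coincidences_le (σ := σ) hn
  have h8 : 1 / l * (10 * n * √n) = n * q / 2 := by
    rw [hl, hA]
    field_simp
    ring
  have h9 := mul_le_mul_of_nonneg_left h7 (by positivity : 0 ≤ 1 / l)
  have h10 : n * q / 2 ≤ n * q + (-1 / l) *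
      walkMean (step (σ := σ)) n (fun h => (h.dep.coincidences : ℝ)) start := by
    rw [neg_div, neg_mul]
    linarith
  refine le_trans (le_of_eq ?_) (mul_le_mul_of_nonneg_left h10 (by positivity))
  have h11 : (n : ℝ) ^ ((1 + α) / 2) = (√n) ^ (α - 1) * n := by
    rw [Real.sqrt_eq_rpow, ← Real.rpow_mul hn'.le, ← Real.rpow_add_one hn'.ne']
    congr 1
    ring
  rw [h11, hl, Real.mul_rpow hApos.le hs.le]
  ring

/-- The sum over `[-n, n]` of the mean of the power `α` of the local time, from above. -/
theorem sum_mean_visits_rpow_le [Nonempty σ] {α : ℝ} (hα0 : 0 < α) (hα : α < 1) {n : ℕ}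
    (hn : 0 < n) :
    ∑ y ∈ Finset.Icc (-n : ℤ) n,
      walkMean (step (σ := σ)) n (fun h => (h.visits y : ℝ) ^ α) start ≤
        8 * (n : ℝ) ^ ((1 + α) / 2) := by
  have hn' : (0 : ℝ) < n := by exact_mod_cast hn
  have hs : 0 < √(n : ℝ) := by positivity
  have hs1 : 1 ≤ √(n : ℝ) := Real.one_le_sqrt.mpr (by exact_mod_cast hn)
  rw [← walkMean_sum]
  have h1 : walkMean (step (σ := σ)) n
      (fun h => ∑ y ∈ Finset.Icc (-n : ℤ) n, (h.visits y : ℝ) ^ α) start ≤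
      walkMean (step (σ := σ)) n (fun h => (√n) ^ α * (2 * (h.rad : ℝ) + (1 + 2 * √n))) start := by
    refine walkMean_le_of_invariant (Inv := Bounded) (fun k z ω hz => hz.step ω) n
      bounded_start fun h hb => ?_
    -- This is `u ^ α ≤ 1 + u` at `u = visits / √n`. The summand `1` is charged only to sites within
    -- the radius, since elsewhere `0 ^ α = 0`.
    have h2 : ∀ y, (h.visits y : ℝ) ^ α ≤
        (√n) ^ α * ((if y ∈ Finset.Icc (-h.rad : ℤ) h.rad then (1 : ℝ) else 0) +
          (1 / √n) * (h.visits y : ℝ)) := by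
      intro y
      split_ifs with hy
      · have h4 := rpow_le_one_add (u := (h.visits y : ℝ) / √n) (by positivity) hα0.le hα.le
        rw [Real.div_rpow (by positivity) hs.le, div_le_iff₀ (by positivity)] at h4
        refine h4.trans (le_of_eq ?_)
        ring
      · have h5 : h.visits y = 0 := by
          rw [visits, List.count_eq_zero_of_not_mem, List.count_eq_zero_of_not_mem]
          · intro hy'
            have := hb.arr_le y hy'
            rw [Finset.mem_Icc] at hy
            omega
          · intro hy'
            have := hb.dep_le y hy'
            rw [Finset.mem_Icc] at hy
            omega
        simp [h5, Real.zero_rpow hα0.ne']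
    refine (Finset.sum_le_sum fun y _ => h2 y).trans ?_
    rw [← Finset.mul_sum, Finset.sum_add_distrib, ← Finset.mul_sum]
    have h6 : ∑ y ∈ Finset.Icc (-n : ℤ) n, (if y ∈ Finset.Icc (-h.rad : ℤ) h.rad then (1 : ℝ)
        else 0) ≤ 2 * h.rad + 1 := by
      rw [← Finset.sum_filter, Finset.sum_const, nsmul_eq_mul, mul_one]
      have : ((Finset.Icc (-n : ℤ) n).filter (· ∈ Finset.Icc (-h.rad : ℤ) h.rad)).card ≤
          (Finset.Icc (-h.rad : ℤ) h.rad).card :=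
        Finset.card_le_card fun y hy => (Finset.mem_filter.mp hy).2
      rw [Int.card_Icc] at this
      have h7 : ((Finset.Icc (-n : ℤ) n).filter (· ∈ Finset.Icc (-h.rad : ℤ) h.rad)).card ≤
          2 * h.rad + 1 := by omega
      exact_mod_cast h7
    have h8 : ∑ y ∈ Finset.Icc (-n : ℤ) n, (h.visits y : ℝ) ≤ 2 * n := by
      have hr := hb.rad_le
      have ha := List.sum_count_eq (Finset.Icc (-n : ℤ) n) h.dep fun a ha => by
        have := hb.dep_le a ha
        rw [Finset.mem_Icc]
        omega
      have hb' := List.sum_count_eq (Finset.Icc (-n : ℤ) n) h.arr fun a ha => by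
        have := hb.arr_le a ha
        rw [Finset.mem_Icc]
        omega
      have : ∑ y ∈ Finset.Icc (-n : ℤ) n, h.visits y ≤ 2 * n := by
        simp only [visits, Finset.sum_add_distrib]
        have := hb.length_dep
        have := hb.length_arr
        omega
      exact_mod_cast this
    refine mul_le_mul_of_nonneg_left ?_ (by positivity)
    have h9 := mul_le_mul_of_nonneg_left h8 (by positivity : 0 ≤ 1 / √(n : ℝ))
    have h10 : 1 / √(n : ℝ) * (2 * n) = 2 * √n := by
      field_simp
      rw [Real.sq_sqrt hn'.le]
    linarith
  refine h1.trans ?_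
  rw [walkMean_const_mul, walkMean_add, walkMean_const_mul, walkMean_const]
  have h2 := mean_rad_le (σ := σ) hn
  have h11 : (n : ℝ) ^ ((1 + α) / 2) = (√n) ^ α * √n := by
    rw [Real.sqrt_eq_rpow, ← Real.rpow_mul hn'.le, ← Real.rpow_add hn']
    congr 1
    ring
  rw [h11, mul_left_comm]
  refine mul_le_mul_of_nonneg_left ?_ (by positivity)
  -- The mean radius contributes `2 * (5 / 2) * √n`, and `5 * √n + 1 + 2 * √n ≤ 8 * √n`.
  linarith

end Trace

end Trace

/-! ### Wreath products with base `ℤ` -/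

namespace IntWreath

variable {B : Type} [Group B]

/-- The wreath product `ℤ ≀ B`. -/
abbrev W (B : Type) [Group B] : Type := Wreath (Multiplicative ℤ) B

/-- The position of the lamplighter. -/
def pos (g : W B) : ℤ := g.right.toAdd

/-- The state of the lamp at `y`. -/
def val (g : W B) (y : ℤ) : B := g.left.1 (Multiplicative.ofAdd y)

/-- The shift of the base by `j`. -/
def shift (j : ℤ) : W B := SemidirectProduct.inr (Multiplicative.ofAdd j)

/-- The lamp at the origin in the state `b`. -/
noncomputable def lamp : B →* W B :=
  SemidirectProduct.inl.comp
    ((MonoidHom.mulSingle (fun _ : Multiplicative ℤ => B) 1).codRestrict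
      (lampGroup (Multiplicative ℤ) B) fun _ =>
        (Set.finite_singleton (1 : Multiplicative ℤ)).subset Pi.mulSupport_mulSingle_subset)

theorem ext_pos_val {g h : W B} (hp : pos g = pos h) (hv : ∀ y, val g y = val h y) : g = h :=
  SemidirectProduct.ext (Subtype.ext (funext fun y => hv y.toAdd)) hp

theorem val_one (y : ℤ) : val (1 : W B) y = 1 := rfl

theorem pos_mul (g h : W B) : pos (g * h) = pos g + pos h := rfl

theorem val_mul (g h : W B) (y : ℤ) : val (g * h) y = val g y * val h (y - pos g) := by
  have : val (g * h) y = val g y * val h (-pos g + y) := rfl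
  rw [this, neg_add_eq_sub]

theorem pos_shift (j : ℤ) : pos (shift j : W B) = j := rfl

theorem val_shift (j y : ℤ) : val (shift j : W B) y = 1 := rfl

theorem pos_lamp (b : B) : pos (lamp b) = 0 := rfl

theorem val_lamp (b : B) (y : ℤ) : val (lamp b) y = if y = 0 then b else 1 := by
  have : val (lamp b) y = (Pi.mulSingle 1 b : Multiplicative ℤ → B) (Multiplicative.ofAdd y) := rfl
  rw [this, Pi.mulSingle_apply]
  rfl

theorem pos_inv (g : W B) : pos g⁻¹ = -pos g := rfl

theorem val_inv (g : W B) (y : ℤ) : val g⁻¹ y = (val g (y + pos g))⁻¹ := by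
  have h := val_mul g g⁻¹ (y + pos g)
  rw [mul_inv_cancel, val_one, add_sub_cancel_right] at h
  exact (inv_eq_of_mul_eq_one_right h.symm).symm

theorem finite_val_ne (g : W B) : {y | val g y ≠ 1}.Finite := by
  have h : (Function.mulSupport g.left.1).Finite := g.left.2
  exact h.preimage Multiplicative.ofAdd.injective.injOn

theorem shift_neg (j : ℤ) : (shift (-j) : W B) = (shift j)⁻¹ := by
  apply ext_pos_val <;> simp [pos_inv, val_inv, pos_shift, val_shift]

theorem shift_eq_zpow (j : ℤ) : (shift j : W B) = shift 1 ^ j := by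
  simp only [shift, ← map_zpow, ← ofAdd_zsmul, smul_eq_mul, mul_one]

/-- The walk from the origin to the right by `k` steps that writes the lamps of `f` from `a` on. -/
noncomputable def sweep (f : ℤ → B) (a : ℤ) (k : ℕ) : W B :=
  ((List.range k).map fun j : ℕ => lamp (f (a + j)) * shift 1).prod

theorem sweep_succ (f : ℤ → B) (a : ℤ) (k : ℕ) :
    sweep f a (k + 1) = sweep f a k * (lamp (f (a + k)) * shift 1) := by
  simp [sweep, List.range_succ]

theorem pos_sweep (f : ℤ → B) (a : ℤ) (k : ℕ) : pos (sweep f a k) = k := by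
  induction k with
  | zero => rfl
  | succ k ih => rw [sweep_succ, pos_mul, pos_mul, ih, pos_lamp, pos_shift]; push_cast; ring

theorem val_sweep (f : ℤ → B) (a : ℤ) (k : ℕ) (y : ℤ) :
    val (sweep f a k) y = if 0 ≤ y ∧ y < k then f (a + y) else 1 := by
  induction k with
  | zero => rw [if_neg (by push_cast; omega)]; rfl
  | succ k ih =>
    rw [sweep_succ, val_mul, val_mul, ih, pos_sweep, val_shift, mul_one, val_lamp]
    by_cases h : y = k
    · subst h; simp
    · rw [if_neg (sub_ne_zero.mpr h), mul_one]
      congr 1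
      simp only [eq_iff_iff]
      push_cast
      omega

/-- Every element is obtained by a sweep over an interval that contains its lamps. -/
theorem eq_sweep (g : W B) (a : ℤ) (k : ℕ) (h : ∀ y, val g y ≠ 1 → a ≤ y ∧ y < a + k) :
    g = shift a * sweep (val g) a k * shift (pos g - (a + k)) := by
  apply ext_pos_val
  · simp only [pos_mul, pos_shift, pos_sweep]; ring
  · intro y
    simp only [val_mul, val_shift, pos_shift, val_sweep, one_mul, mul_one, add_sub_cancel]
    by_cases hy : val g y = 1
    · simp [hy]
    · rw [if_pos]
      have := h y hy
      omega

theorem exists_interval (g : W B) : ∃ R : ℕ, ∀ y, val g y ≠ 1 → y.natAbs ≤ R := by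
  obtain ⟨R, hR⟩ := ((finite_val_ne g).image Int.natAbs).bddAbove
  exact ⟨R, fun y hy => hR ⟨y, hy, rfl⟩⟩

/-- The sweep moves on after each of its `2 * R + 1` lamps, so it ends at `R + 1`, one past the
interval. -/
theorem eq_sweep_of_natAbs_le (g : W B) (R : ℕ) (h : ∀ y, val g y ≠ 1 → y.natAbs ≤ R) :
    g = shift (-R) * sweep (val g) (-R) (2 * R + 1) * shift (pos g - (R + 1)) := by
  have := eq_sweep g (-R) (2 * R + 1) fun y hy => by have := h y hy; push_cast; omega
  convert this using 3
  push_cast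
  ring

theorem mem_of_shift_of_lamp {H : Subgroup (W B)} (h1 : shift 1 ∈ H) (h2 : ∀ b, lamp b ∈ H)
    (g : W B) : g ∈ H := by
  have hs : ∀ j : ℤ, (shift j : W B) ∈ H := fun j => by
    rw [shift_eq_zpow]
    exact H.zpow_mem h1 j
  obtain ⟨R, hR⟩ := exists_interval g
  rw [eq_sweep_of_natAbs_le g R hR]
  refine H.mul_mem (H.mul_mem (hs _) (H.list_prod_mem fun x hx => ?_)) (hs _)
  obtain ⟨j, -, rfl⟩ := List.mem_map.mp hx
  exact H.mul_mem (h2 _) h1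

/-! ### The word length of a wreath product -/

section Length

variable {S : Finset B} {T : Finset (W B)}

/-- The total length of the lamps is subadditive and symmetric, because products and inverses merely
shift the lamp indices. Hence it is dominated by every word length. -/
theorem exists_sum_wordLength_val_le (hS : Subgroup.closure (S : Set B) = ⊤)
    (hT : Subgroup.closure (T : Set (W B)) = ⊤) :
    ∃ K : ℝ, 0 < K ∧ ∀ (g : W B) (Y : Finset ℤ),
      ∑ y ∈ Y, (wordLength S (val g y) : ℝ) ≤ K * wordLength T g := by
  have hfin : ∀ g : W B, (Function.support fun y => (wordLength S (val g y) : ℝ)).Finite := by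
    intro g
    refine (finite_val_ne g).subset fun y hy hy' => hy ?_
    simp [hy', wordLength_one]
  obtain ⟨K, hK, h⟩ := exists_le_mul_wordLength hT
    (fun g => ∑ᶠ y, (wordLength S (val g y) : ℝ)) (by simp [val_one, wordLength_one])
    (by
      intro g h
      have hh : (Function.support fun y => (wordLength S (val h (y - pos g)) : ℝ)).Finite :=
        (hfin h).preimage (sub_left_injective.injOn)
      have e : ∑ᶠ y, (wordLength S (val h y) : ℝ) =
          ∑ᶠ y, (wordLength S (val h (y - pos g)) : ℝ) :=
        (finsum_comp_equiv (Equiv.subRight (pos g))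
          (f := fun y => (wordLength S (val h y) : ℝ))).symm
      rw [e, ← finsum_add_distrib (hfin g) hh]
      refine finsum_le_finsum' (hfin _) (((hfin g).union hh).subset
        (Function.support_add _ _)) fun y => ?_
      beta_reduce
      rw [val_mul]
      exact_mod_cast wordLength_mul_le hS (val g y) (val h (y - pos g)))
    (by
      intro g
      have hg : (Function.support fun y => (wordLength S (val g (y + pos g)) : ℝ)).Finite :=
        (hfin g).preimage ((add_left_injective _).injOn)
      have e : ∑ᶠ y, (wordLength S (val g y) : ℝ) =
          ∑ᶠ y, (wordLength S (val g (y + pos g)) : ℝ) :=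
        (finsum_comp_equiv (Equiv.addRight (pos g))
          (f := fun y => (wordLength S (val g y) : ℝ))).symm
      rw [e]
      refine finsum_le_finsum' (hfin _) hg fun y => ?_
      beta_reduce
      rw [val_inv]
      exact_mod_cast wordLength_inv_le hS (val g (y + pos g)))
  refine ⟨K, hK, fun g Y => le_trans ?_ (h g)⟩
  rw [finsum_eq_sum_of_support_subset (s := Y ∪ (hfin g).toFinset) _ (by simp)]
  exact Finset.sum_le_sum_of_subset_of_nonneg Finset.subset_union_left
    fun _ _ _ => by positivity

/-- An explicit word: go to `-R`, write all lamps in one sweep to the right, return to `pos g`. -/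
theorem exists_wordLength_le (hS : Subgroup.closure (S : Set B) = ⊤)
    (hT : Subgroup.closure (T : Set (W B)) = ⊤) :
    ∃ K : ℝ, 0 < K ∧ ∀ (g : W B) (R : ℕ) (Y : Finset ℤ), (pos g).natAbs ≤ R →
      (∀ y, val g y ≠ 1 → y.natAbs ≤ R) → Finset.Icc (-R : ℤ) R ⊆ Y →
        (wordLength T g : ℝ) ≤ K * (R + 1 + ∑ y ∈ Y, (wordLength S (val g y) : ℝ)) := by
  obtain ⟨K, hK, h⟩ := exists_le_mul_wordLength hS (fun b => (wordLength T (lamp b) : ℝ))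
    (by simp [wordLength_one])
    (fun a b => by rw [map_mul]; exact_mod_cast wordLength_mul_le hT _ _)
    (fun b => by rw [map_inv]; exact_mod_cast wordLength_inv_le hT _)
  set A : ℝ := (wordLength T (shift 1 : W B) : ℝ) with hA
  have hA0 : 0 ≤ A := by positivity
  have hmul : ∀ g h : W B, (wordLength T (g * h) : ℝ) ≤ wordLength T g + wordLength T h :=
    fun g h => by exact_mod_cast wordLength_mul_le hT g h
  have hshift : ∀ j : ℤ, (wordLength T (shift j : W B) : ℝ) ≤ A * j.natAbs := fun j => by
    rw [shift_eq_zpow, mul_comm]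
    have h := wordLength_zpow_le hT (shift 1) j
    rw [hA]
    exact_mod_cast h
  have hsweep : ∀ (f : ℤ → B) (a : ℤ) (k : ℕ), (wordLength T (sweep f a k) : ℝ) ≤
      A * k + K * ∑ j ∈ Finset.range k, (wordLength S (f (a + j)) : ℝ) := by
    intro f a k
    induction k with
    | zero => simp [sweep, wordLength_one]
    | succ k ih =>
      rw [sweep_succ, Finset.sum_range_succ]
      have h1 := hmul (sweep f a k) (lamp (f (a + k)) * shift 1)
      have h2 := hmul (lamp (f (a + k))) (shift 1)
      have h3 := h (f (a + k))
      push_cast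
      linarith
  -- The three parts use at most `R`, `2 * R + 1` and `2 * R + 1` shifts, together at most `5 * (R +
  -- 1)`.
  refine ⟨5 * A + K, by positivity, fun g R Y hp hv hY => ?_⟩
  have hg := eq_sweep_of_natAbs_le g R hv
  have h1 := hmul (shift (-R) * sweep (val g) (-R) (2 * R + 1)) (shift (pos g - (R + 1)))
  have h2 := hmul (shift (-R)) (sweep (val g) (-R) (2 * R + 1))
  have h3 := hshift (-R)
  have h4 := hshift (pos g - (R + 1))
  have h5 := hsweep (val g) (-R) (2 * R + 1)
  rw [← hg] at h1
  have h6 : ((pos g - (R + 1)).natAbs : ℝ) ≤ 2 * R + 1 := by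
    have : (pos g - (R + 1)).natAbs ≤ 2 * R + 1 := by omega
    exact_mod_cast this
  have h7 : ∑ j ∈ Finset.range (2 * R + 1), (wordLength S (val g (-R + j)) : ℝ) ≤
      ∑ y ∈ Y, (wordLength S (val g y) : ℝ) := by
    have : ∑ j ∈ Finset.range (2 * R + 1), (wordLength S (val g (-R + j)) : ℝ) =
        ∑ y ∈ (Finset.range (2 * R + 1)).image (fun j : ℕ => (-R + j : ℤ)),
          (wordLength S (val g y) : ℝ) := by
      rw [Finset.sum_image]
      intro a _ b _ hab
      simpa using hab
    rw [this]
    refine Finset.sum_le_sum_of_subset_of_nonneg (fun y hy => hY ?_) fun _ _ _ => by positivity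
    obtain ⟨j, hj, rfl⟩ := Finset.mem_image.mp hy
    rw [Finset.mem_range] at hj
    rw [Finset.mem_Icc]
    omega
  have h8 : A * ((pos g - (R + 1)).natAbs : ℝ) ≤ A * (2 * R + 1) := by gcongr
  have h9 := mul_le_mul_of_nonneg_left h7 hK.le
  have h10 : 0 ≤ ∑ y ∈ Y, (wordLength S (val g y) : ℝ) := by positivity
  have h11 : 0 ≤ A * ∑ y ∈ Y, (wordLength S (val g y) : ℝ) := by positivity
  have h12 : 0 ≤ K * ((R : ℝ) + 1) := by positivity
  have h13 : 0 ≤ A * (R : ℝ) := by positivity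
  simp only [Int.natAbs_neg, Int.natAbs_natCast] at h3
  push_cast at h5
  nlinarith

end Length

end IntWreath

/-! ### The law of a single lamp -/

section Site

variable {B : Type} [Group B] {σ : Type} [Fintype σ] (e : σ → B) (y : ℤ)

/-- The walk of the position together with the lamp at `y`: each move switches the lamps at its two
ends. -/
def siteStep (p : ℤ × B) : Move σ → ℤ × B
  | none => p
  | some (ε, s, s') => (p.1 + dirStep ε,
      p.2 * (if p.1 = y then e s else 1) * (if p.1 + dirStep ε = y then e s' else 1))

/-- A label that is used makes one step of the walk on `B`; a label that is not used only
contributes a factor `|σ|`. -/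
theorem sum_sum_switch [Nonempty σ] (p q : Prop) [Decidable p] [Decidable q] (F : B → ℝ) (b : B) :
    ∑ s, ∑ s', F (b * (if p then e s else 1) * (if q then e s' else 1)) =
      (Fintype.card σ : ℝ) ^ 2 * walkMean (fun b s => b * e s)
        ((if p then 1 else 0) + (if q then 1 else 0)) F b := by
  have hc : (Fintype.card σ : ℝ) ≠ 0 := by exact_mod_cast Fintype.card_ne_zero
  by_cases hp : p <;> by_cases hq : q <;>
    simp only [hp, hq, if_true, if_false, mul_one, add_zero, zero_add, walkMean_add_steps,
      walkMean_one, walkMean_zero, stepMean, Finset.sum_const, Finset.card_univ, nsmul_eq_mul,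
      ← Finset.mul_sum, ← Finset.sum_div] <;> field_simp

/-- The mean of `Φ` when the lamp at `y` has made as many independent steps as the history has
visits to `y`. -/
noncomputable def localMean (Φ : ℤ × B → ℝ) (h : Trace) : ℝ :=
  walkMean (fun b s => b * e s) (h.visits y) (fun b => Φ (h.pos, b)) 1

theorem stepMean_siteStep [Nonempty σ] (Φ : ℤ × B → ℝ) (x : ℤ) (b : B) :
    stepMean (siteStep e y) Φ (x, b) = (1 - moveProb σ) * Φ (x, b) + moveProb σ / 2 *
      (walkMean (fun b s => b * e s) ((if x = y then 1 else 0) +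
          (if x + dirStep true = y then 1 else 0)) (fun b => Φ (x + dirStep true, b)) b +
        walkMean (fun b s => b * e s) ((if x = y then 1 else 0) +
          (if x + dirStep false = y then 1 else 0)) (fun b => Φ (x + dirStep false, b)) b) := by
  have hc : (2 * (Fintype.card σ : ℝ) ^ 2 + 1) ≠ 0 := by positivity
  unfold stepMean moveProb
  rw [card_move, Fintype.sum_option, Fintype.sum_prod_type, Fintype.sum_bool]
  simp only [Fintype.sum_prod_type, siteStep]
  rw [sum_sum_switch e (x = y) (x + dirStep true = y) (fun b => Φ (x + dirStep true, b)),
    sum_sum_switch e (x = y) (x + dirStep false = y) (fun b => Φ (x + dirStep false, b))]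
  field_simp
  ring

theorem visits_go (h : Trace) (ε : Bool) : (h.go ε).visits y =
    h.visits y + ((if h.pos = y then 1 else 0) + (if h.pos + dirStep ε = y then 1 else 0)) := by
  simp only [Trace.visits, Trace.go, List.count_cons, beq_iff_eq]
  ring

/-- A move adds to `visits y` exactly the number of switches that it makes at `y`, so averaging over
the labels commutes with averaging over the path. -/
theorem localMean_stepMean [Nonempty σ] (Φ : ℤ × B → ℝ) :
    localMean e y (stepMean (siteStep e y) Φ) =
      stepMean (Trace.step (σ := σ)) (localMean e y Φ) := by
  funext h
  rw [Trace.stepMean_eq]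
  simp only [localMean, stepMean_siteStep, walkMean_add, walkMean_const_mul, visits_go,
    walkMean_add_steps]
  simp only [Trace.go]
  ring

theorem walkMean_siteStep [Nonempty σ] (n : ℕ) (Φ : ℤ × B → ℝ) :
    walkMean (siteStep e y) n Φ (0, 1) =
      walkMean (Trace.step (σ := σ)) n (localMean e y Φ) Trace.start := by
  have h : Function.Semiconj (localMean e y) (stepMean (siteStep e y))
      (stepMean (Trace.step (σ := σ))) := fun Φ => localMean_stepMean e y Φ
  -- The initial history has no visits, so there `localMean` is evaluation at `(0, 1)`.
  exact congrFun ((h.iterate_right n) Φ) Trace.start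

end Site

/-! ### The switch-walk-switch walk -/

namespace IntWreath

section Walk

variable {B : Type} [Group B] {σ : Type} (e : σ → B)

/-- The step that belongs to a move: switch, walk, switch. -/
noncomputable def switchWalkSwitch : Move σ → W B
  | none => 1
  | some (ε, s, s') => lamp (e s) * shift (dirStep ε) * lamp (e s')

theorem pos_switchWalkSwitch (ε : Bool) (s s' : σ) :
    pos (switchWalkSwitch e (some (ε, s, s'))) = dirStep ε := by
  simp [switchWalkSwitch, pos_mul, pos_lamp, pos_shift]

theorem val_switchWalkSwitch (ε : Bool) (s s' : σ) (y : ℤ) :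
    val (switchWalkSwitch e (some (ε, s, s'))) y =
      (if y = 0 then e s else 1) * (if y = dirStep ε then e s' else 1) := by
  simp [switchWalkSwitch, val_mul, pos_mul, val_lamp, val_shift, pos_lamp, pos_shift, sub_eq_zero]

theorem dirStep_ne_zero (ε : Bool) : dirStep ε ≠ 0 := by cases ε <;> decide

theorem dirStep_injective : Function.Injective dirStep := by decide

theorem dirStep_not (ε : Bool) : dirStep (!ε) = -dirStep ε := by cases ε <;> rfl

/-- Uniform choices must give the uniform measure on the set of steps. The position recovers the
direction, and the lamps at the two distinct ends recover the labels. -/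
theorem switchWalkSwitch_injective (he : Function.Injective e) :
    Function.Injective (switchWalkSwitch e) := by
  rintro (_ | ⟨ε, s, s'⟩) (_ | ⟨δ, t, t'⟩) h
  · rfl
  · have := congrArg pos h
    rw [pos_switchWalkSwitch] at this
    exact absurd this.symm (dirStep_ne_zero δ)
  · have := congrArg pos h
    rw [pos_switchWalkSwitch] at this
    exact absurd this (dirStep_ne_zero ε)
  · have hp := congrArg pos h
    rw [pos_switchWalkSwitch, pos_switchWalkSwitch] at hp
    obtain rfl := dirStep_injective hp
    have h0 := congrArg (val · 0) h
    have h1 := congrArg (val · (dirStep ε)) h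
    simp only [val_switchWalkSwitch, (dirStep_ne_zero ε).symm, dirStep_ne_zero, if_true, if_false,
      mul_one, one_mul] at h0 h1
    rw [he h0, he h1]

theorem walkMean_val [Fintype σ] [Nonempty σ] (n : ℕ) (y : ℤ) (F : B → ℝ) :
    walkMean (fun g ω => g * switchWalkSwitch e ω) n (fun g => F (val g y)) 1 =
      walkMean (Trace.step (σ := σ)) n
        (fun h => walkMean (fun b s => b * e s) (h.visits y) F 1) Trace.start := by
  rw [walkMean_map (step' := siteStep e y) (π := fun g : W B => (pos g, val g y))
    (F := fun p => F p.2)]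
  · exact walkMean_siteStep e y n _
  · rintro g (_ | ⟨ε, s, s'⟩)
    · simp [switchWalkSwitch, siteStep]
    · simp only [pos_mul, val_mul, pos_switchWalkSwitch, val_switchWalkSwitch, siteStep,
        sub_eq_iff_eq_add, mul_assoc, eq_comm (a := y), add_comm (dirStep ε),
        zero_add]

/-- The joint walk of the group element and of the history of its position. -/
noncomputable def jointStep (p : W B × Trace) (ω : Move σ) : W B × Trace :=
  (p.1 * switchWalkSwitch e ω, p.2.step ω)

/-- The history is that of the position, and all lamps outside its range are off. -/
structure Joint (n : ℕ) (p : W B × Trace) : Prop where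
  bounded : p.2.Bounded n
  pos_eq : pos p.1 = p.2.pos
  natAbs_le : ∀ y, val p.1 y ≠ 1 → y.natAbs ≤ p.2.rad

theorem Joint.step {n : ℕ} {p : W B × Trace} (hp : Joint n p) (ω : Move σ) :
    Joint (n + 1) (jointStep e p ω) := by
  obtain ⟨h1, h2, h3⟩ := hp
  refine ⟨h1.step ω, ?_, ?_⟩
  · rcases ω with _ | ⟨ε, s, s'⟩
    · simpa [jointStep, switchWalkSwitch, Trace.step] using h2
    · simp [jointStep, pos_mul, pos_switchWalkSwitch, h2, Trace.step, Trace.go]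
  · rcases ω with _ | ⟨ε, s, s'⟩
    · simpa [jointStep, switchWalkSwitch, Trace.step] using h3
    · intro y hy
      simp only [jointStep, val_mul, val_switchWalkSwitch, h2] at hy
      simp only [jointStep, Trace.step, Trace.go]
      by_cases hv : val p.1 y = 1
      · rw [hv, one_mul] at hy
        by_cases h0 : y - p.2.pos = 0
        · have := h1.pos_le
          have : y.natAbs ≤ p.2.rad := by rwa [sub_eq_zero.mp h0]
          exact this.trans (le_max_left _ _)
        · rw [if_neg h0, one_mul] at hy
          by_cases h4 : y - p.2.pos = dirStep ε
          · rw [← h4, add_sub_cancel]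
            exact le_max_right _ _
          · simp [h4] at hy
      · exact (h3 y hv).trans (le_max_left _ _)

end Walk

/-! ### The drift of the switch-walk-switch walk -/

section Drift

variable {B : Type} [Group B] {σ : Type} [Fintype σ] [Nonempty σ] {e : σ → B} {S : Finset B}
  {T : Finset (W B)} {α : ℝ}

theorem exists_le_walkMean_wordLength (hS : Subgroup.closure (S : Set B) = ⊤)
    (hT : Subgroup.closure (T : Set (W B)) = ⊤) (hα0 : 0 < α) (hα : α < 1) {c : ℝ} (hc : 0 < c)
    (hB : ∀ n : ℕ, c * (n : ℝ) ^ α ≤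
      walkMean (fun b s => b * e s) n (fun b => (wordLength S b : ℝ)) 1) :
    ∃ c' : ℝ, 0 < c' ∧ ∀ n : ℕ, 0 < n → c' * (n : ℝ) ^ ((1 + α) / 2) ≤
      walkMean (fun g ω => g * switchWalkSwitch e ω) n (fun g => (wordLength T g : ℝ)) 1 := by
  obtain ⟨K, hK, h⟩ := exists_sum_wordLength_val_le hS hT
  obtain ⟨d, hd, h'⟩ := Trace.exists_le_sum_mean_visits_rpow (σ := σ) hα0 hα
  refine ⟨K⁻¹ * (c * d), by positivity, fun n hn => ?_⟩
  have h1 := walkMean_mono (step := fun g ω => g * switchWalkSwitch e ω) n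
    (fun g => h g (Finset.Icc (-n : ℤ) n)) 1
  rw [walkMean_const_mul, walkMean_sum] at h1
  have h2 : c * (d * (n : ℝ) ^ ((1 + α) / 2)) ≤ ∑ y ∈ Finset.Icc (-n : ℤ) n,
      walkMean (fun g ω => g * switchWalkSwitch e ω) n
        (fun g => (wordLength S (val g y) : ℝ)) 1 := by
    refine (mul_le_mul_of_nonneg_left (h' n hn) hc.le).trans ?_
    rw [Finset.mul_sum]
    refine Finset.sum_le_sum fun y _ => ?_
    rw [walkMean_val e n y (fun b => (wordLength S b : ℝ)), ← walkMean_const_mul]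
    exact walkMean_mono n (fun z => hB _) _
  rw [mul_assoc, inv_mul_le_iff₀ hK, mul_assoc]
  exact h2.trans h1

theorem exists_walkMean_wordLength_le (hS : Subgroup.closure (S : Set B) = ⊤)
    (hT : Subgroup.closure (T : Set (W B)) = ⊤) (hα0 : 0 < α) (hα : α < 1) {C : ℝ} (hC : 0 < C)
    (hB : ∀ n : ℕ, walkMean (fun b s => b * e s) n (fun b => (wordLength S b : ℝ)) 1 ≤
      C * (n : ℝ) ^ α) :
    ∃ C' : ℝ, 0 < C' ∧ ∀ n : ℕ, 0 < n →
      walkMean (fun g ω => g * switchWalkSwitch e ω) n (fun g => (wordLength T g : ℝ)) 1 ≤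
        C' * (n : ℝ) ^ ((1 + α) / 2) := by
  obtain ⟨K, hK, h⟩ := exists_wordLength_le hS hT
  -- Radius and additive constant give `5 / 2 + 1 ≤ 4`, since `√n` and `1` are at most `n ^ ((1 + α)
  -- / 2)`; the lamps give `8 * C`.
  refine ⟨K * (4 + 8 * C), by positivity, fun n hn => ?_⟩
  have h1 : walkMean (jointStep e) n (fun p => (wordLength T p.1 : ℝ)) (1, Trace.start) ≤
      walkMean (jointStep e) n (fun p => K * ((p.2.rad : ℝ) + 1 +
        ∑ y ∈ Finset.Icc (-n : ℤ) n, (wordLength S (val p.1 y) : ℝ))) (1, Trace.start) := by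
    refine walkMean_le_of_invariant (Inv := Joint) (fun k z ω hz => hz.step e ω) n
      ⟨Trace.bounded_start, rfl, fun y hy => absurd (val_one y) hy⟩ fun p hp => ?_
    refine h p.1 p.2.rad _ ?_ hp.natAbs_le ?_
    · rw [hp.pos_eq]; exact hp.bounded.pos_le
    · have : (p.2.rad : ℤ) ≤ n := by exact_mod_cast hp.bounded.rad_le
      exact Finset.Icc_subset_Icc (by omega) this
  have hfst : ∀ F : W B → ℝ, walkMean (jointStep e) n (fun p => F p.1) (1, Trace.start) =
      walkMean (fun g ω => g * switchWalkSwitch e ω) n F 1 := fun F =>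
    walkMean_map (π := Prod.fst) (fun _ _ => rfl) n F (1, Trace.start)
  have hsnd : ∀ F : Trace → ℝ, walkMean (jointStep e) n (fun p => F p.2) (1, Trace.start) =
      walkMean (Trace.step (σ := σ)) n F Trace.start := fun F =>
    walkMean_map (π := Prod.snd) (fun _ _ => rfl) n F (1, Trace.start)
  rw [walkMean_const_mul, walkMean_add, walkMean_add, walkMean_const,
    hfst (fun g => (wordLength T g : ℝ)), hsnd (fun h => (h.rad : ℝ)),
    hfst (fun g => ∑ y ∈ Finset.Icc (-n : ℤ) n, (wordLength S (val g y) : ℝ)), walkMean_sum] at h1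
  refine h1.trans ?_
  have h2 : ∑ y ∈ Finset.Icc (-n : ℤ) n, walkMean (fun g ω => g * switchWalkSwitch e ω) n
      (fun g => (wordLength S (val g y) : ℝ)) 1 ≤ C * (8 * (n : ℝ) ^ ((1 + α) / 2)) := by
    refine le_trans ?_ (mul_le_mul_of_nonneg_left
      (Trace.sum_mean_visits_rpow_le (σ := σ) hα0 hα hn) hC.le)
    rw [Finset.mul_sum]
    refine Finset.sum_le_sum fun y _ => ?_
    rw [walkMean_val e n y (fun b => (wordLength S b : ℝ)), ← walkMean_const_mul]
    exact walkMean_mono n (fun z => hB _) _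
  have h3 := Trace.mean_rad_le (σ := σ) hn
  have hn1 : (1 : ℝ) ≤ n := by exact_mod_cast hn
  have h4 : √(n : ℝ) ≤ (n : ℝ) ^ ((1 + α) / 2) := by
    rw [Real.sqrt_eq_rpow]
    exact Real.rpow_le_rpow_of_exponent_le hn1 (by linarith)
  have h5 : 1 ≤ (n : ℝ) ^ ((1 + α) / 2) := Real.one_le_rpow hn1 (by linarith)
  rw [mul_assoc]
  refine mul_le_mul_of_nonneg_left ?_ hK.le
  linarith

end Drift

/-- The steps of the switch-walk-switch walk generate the wreath product. -/
theorem closure_range_switchWalkSwitch {B : Type} [Group B] {S : Finset B} (h1 : 1 ∈ S)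
    (hS : Subgroup.closure (S : Set B) = ⊤) :
    Subgroup.closure (Set.range (switchWalkSwitch (fun s : S => (s : B)))) = ⊤ := by
  set H := Subgroup.closure (Set.range (switchWalkSwitch (fun s : S => (s : B)))) with hH
  have hmem : ∀ b ∈ S, lamp b * shift 1 ∈ H := fun b hb => by
    refine Subgroup.subset_closure ⟨some (true, ⟨b, hb⟩, ⟨1, h1⟩), ?_⟩
    simp [switchWalkSwitch, dirStep]
  have hs : (shift 1 : W B) ∈ H := by simpa using hmem 1 h1
  refine eq_top_iff.mpr fun g _ => mem_of_shift_of_lamp hs (fun b => ?_) g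
  have : Subgroup.closure (S : Set B) ≤ H.comap lamp := by
    rw [Subgroup.closure_le]
    intro b hb
    exact (H.mul_mem_cancel_right hs).mp (hmem b hb)
  exact this (hS ▸ Subgroup.mem_top b)

/-- Switching at both ends makes the step set symmetric: the inverse reverses the move and exchanges
the inverted labels. -/
theorem inv_mem_range_switchWalkSwitch {B : Type} [Group B] {S : Finset B}
    (hS : ∀ s ∈ S, s⁻¹ ∈ S) {g : W B} (hg : g ∈ Set.range (switchWalkSwitch (fun s : S => (s : B)))) :
    g⁻¹ ∈ Set.range (switchWalkSwitch (fun s : S => (s : B))) := by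
  obtain ⟨_ | ⟨ε, s, s'⟩, rfl⟩ := hg
  · exact ⟨none, by simp [switchWalkSwitch]⟩
  · refine ⟨some (!ε, ⟨_, hS _ s'.2⟩, ⟨_, hS _ s.2⟩), ?_⟩
    simp [switchWalkSwitch, dirStep_not, shift_neg, mul_assoc]

end IntWreath

/-! ### Simple random walks with drift of order `n ^ α` -/

/-- Uniform measure on some finite symmetric generating set that contains the identity has drift of
order `n ^ α` for all word lengths. -/
def HasPowerDrift (G : Type) [Group G] (α : ℝ) : Prop :=
  ∃ (S : Finset G) (hS : S.Nonempty), 1 ∈ S ∧ (∀ s ∈ S, s⁻¹ ∈ S) ∧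
    Subgroup.closure (S : Set G) = ⊤ ∧
    ∀ T : Finset G, Subgroup.closure (T : Set G) = ⊤ → ∃ c C : ℝ, 0 < c ∧ 0 < C ∧ ∀ n : ℕ,
      c * (n : ℝ) ^ α ≤ drift T (PMF.uniformOfFinset S hS) n ∧
        drift T (PMF.uniformOfFinset S hS) n ≤ C * (n : ℝ) ^ α

theorem HasPowerDrift.wreath {B : Type} [Group B] {α : ℝ} (hα0 : 0 < α) (hα : α < 1)
    (h : HasPowerDrift B α) : HasPowerDrift (Wreath (Multiplicative ℤ) B) ((1 + α) / 2) := by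
  classical
  obtain ⟨S, hS, h1, hinv, hgen, hd⟩ := h
  have : Nonempty S := hS.to_subtype
  set e : S → B := fun s => s with he
  -- On `B` a single word length suffices; the comparison lemmas for `ℤ ≀ B` already allow every
  -- `T`.
  obtain ⟨c, C, hc, hC, hcC⟩ := hd S hgen
  simp only [drift_uniformOfFinset e Subtype.val_injective hS (by simp [he])] at hcC
  set f := IntWreath.switchWalkSwitch e with hf
  have hR : ((Finset.univ.image f : Finset _) : Set (IntWreath.W B)) = Set.range f := by simp
  have hne : (Finset.univ.image f).Nonempty := Finset.univ_nonempty.image f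
  have hmem : ∀ g, g ∈ Finset.univ.image f ↔ g ∈ Set.range f := fun g => by simp
  refine ⟨Finset.univ.image f, hne, (hmem _).mpr ⟨none, rfl⟩, fun s hs => ?_, ?_, fun T hT => ?_⟩
  · exact (hmem _).mpr (IntWreath.inv_mem_range_switchWalkSwitch hinv ((hmem s).mp hs))
  · rw [hR]
    exact IntWreath.closure_range_switchWalkSwitch h1 hgen
  · obtain ⟨c', hc', hl⟩ :=
      IntWreath.exists_le_walkMean_wordLength hgen hT hα0 hα hc fun n => (hcC n).1
    obtain ⟨C', hC', hu⟩ :=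
      IntWreath.exists_walkMean_wordLength_le hgen hT hα0 hα hC fun n => (hcC n).2
    refine ⟨c', C', hc', hC', fun n => ?_⟩
    rw [drift_uniformOfFinset f (IntWreath.switchWalkSwitch_injective e Subtype.val_injective) hne
      hR]
    rcases n.eq_zero_or_pos with rfl | hn
    · have : (1 + α) / 2 ≠ 0 := by linarith
      simp [walkMean_zero, wordLength_one, Real.zero_rpow this]
    · exact ⟨hl n hn, hu n hn⟩

/-! ### The lazy simple random walk on `ℤ` -/

/-- The group element of a move on `ℤ`. -/
def intStep : Move Unit → Multiplicative ℤ
  | none => 1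
  | some (ε, _, _) => Multiplicative.ofAdd (dirStep ε)

/-- Second and fourth moments bound the first from below through `u ^ 2 - u ^ 4 ≤ u` at `u = |pos| /
l`. For `l = 4 * √n` and `moveProb Unit = 2 / 3` the constant is `1/6 - 7/64 = 11/192`. -/
theorem Trace.exists_le_mean_abs_pos :
    ∃ c : ℝ, 0 < c ∧ ∀ n : ℕ, 0 < n → c * √n ≤
      walkMean (Trace.step (σ := Unit)) n (fun h => |(h.pos : ℝ)|) Trace.start := by
  refine ⟨11 / 192, by norm_num, fun n hn => ?_⟩
  have hn' : (0 : ℝ) < n := by exact_mod_cast hn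
  have hs : 0 < √(n : ℝ) := by positivity
  have hsq : √(n : ℝ) ^ 2 = n := Real.sq_sqrt hn'.le
  set l := 4 * √(n : ℝ) with hl
  have hlpos : 0 < l := by positivity
  have h1 := walkMean_mono (step := Trace.step (σ := Unit)) n
    (F := fun h => 1 / l * (h.pos : ℝ) ^ 2 + (-1 / l ^ 3) * (h.pos : ℝ) ^ 4)
    (G := fun h => |(h.pos : ℝ)|) (fun h => by
      have key : ∀ u : ℝ, 0 ≤ u → u ^ 2 - u ^ 4 ≤ u := by
        intro u hu
        rcases le_total u 1 with h | h
        · nlinarith [pow_nonneg hu 4]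
        · nlinarith [pow_le_pow_right₀ h (show 2 ≤ 4 by norm_num)]
      have := key (|(h.pos : ℝ)| / l) (by positivity)
      rw [div_pow, div_pow, le_div_iff₀ hlpos, sq_abs, ← abs_pow,
        abs_of_nonneg (by positivity : (0 : ℝ) ≤ (h.pos : ℝ) ^ 4)] at this
      refine le_trans (le_of_eq ?_) this
      field_simp
      ring) Trace.start
  rw [walkMean_add, walkMean_const_mul, walkMean_const_mul, Trace.mean_pos_sq] at h1
  have h2 := mul_le_mul_of_nonneg_left (Trace.mean_pos_pow_four_le (σ := Unit) n)
    (by positivity : 0 ≤ 1 / l ^ 3)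
  have hq : moveProb Unit = 2 / 3 := by simp [moveProb]; norm_num
  have h3 : 1 / l * (n * moveProb Unit) - 1 / l ^ 3 * (7 * (n : ℝ) ^ 2) = 11 / 192 * √n := by
    rw [hq, hl]
    field_simp
    rw [show √(n : ℝ) ^ 4 = (√(n : ℝ) ^ 2) ^ 2 by ring, hsq]
    ring
  rw [neg_div] at h1
  linarith

theorem Trace.mean_abs_pos_le {n : ℕ} (hn : 0 < n) :
    walkMean (Trace.step (σ := Unit)) n (fun h => |(h.pos : ℝ)|) Trace.start ≤ 5 / 2 * √n := by
  refine le_trans ?_ (Trace.mean_rad_le (σ := Unit) hn)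
  refine walkMean_le_of_invariant (Inv := Trace.Bounded) (fun k z ω hz => hz.step ω) n
    Trace.bounded_start fun h hb => ?_
  rw [← Int.cast_abs, ← Nat.cast_natAbs]
  exact_mod_cast hb.pos_le

theorem hasPowerDrift_int : HasPowerDrift (Multiplicative ℤ) (1 / 2) := by
  classical
  have hinj : Function.Injective intStep := by
    rintro (_ | ⟨ε, ⟨⟩, ⟨⟩⟩) (_ | ⟨δ, ⟨⟩, ⟨⟩⟩) h
    · rfl
    · exact absurd (congrArg Multiplicative.toAdd h).symm (IntWreath.dirStep_ne_zero δ)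
    · exact absurd (congrArg Multiplicative.toAdd h) (IntWreath.dirStep_ne_zero ε)
    · rw [IntWreath.dirStep_injective (congrArg Multiplicative.toAdd h)]
  have hR : ((Finset.univ.image intStep : Finset _) : Set (Multiplicative ℤ)) = Set.range intStep :=
    by simp
  have hmem : ∀ g, g ∈ Finset.univ.image intStep ↔ g ∈ Set.range intStep := fun g => by simp
  have hne : (Finset.univ.image intStep).Nonempty := Finset.univ_nonempty.image intStep
  have hzpow : ∀ g : Multiplicative ℤ, g = Multiplicative.ofAdd 1 ^ g.toAdd := fun g => by
    rw [← ofAdd_zsmul]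
    simp
  refine ⟨Finset.univ.image intStep, hne, (hmem _).mpr ⟨none, rfl⟩, fun s hs => ?_, ?_, fun T hT => ?_⟩
  · rw [hmem] at hs ⊢
    obtain ⟨_ | ⟨ε, _, _⟩, rfl⟩ := hs
    · exact ⟨none, rfl⟩
    · exact ⟨some (!ε, (), ()), by simp [intStep, IntWreath.dirStep_not]⟩
  · rw [hR]
    refine eq_top_iff.mpr fun g _ => ?_
    have h1 : Multiplicative.ofAdd 1 ∈ Subgroup.closure (Set.range intStep) :=
      Subgroup.subset_closure (Set.mem_range.mpr ⟨some (true, (), ()), rfl⟩)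
    rw [hzpow g]
    exact Subgroup.zpow_mem _ h1 _
  · obtain ⟨K, hK, hl⟩ := exists_le_mul_wordLength hT (fun g => |(g.toAdd : ℝ)|) (by simp)
      (fun g h => by simpa using abs_add_le (g.toAdd : ℝ) h.toAdd) (by simp)
    set A : ℝ := (wordLength T (Multiplicative.ofAdd (1 : ℤ)) : ℝ) with hA
    have hu : ∀ g : Multiplicative ℤ, (wordLength T g : ℝ) ≤ (A + 1) * |(g.toAdd : ℝ)| := by
      intro g
      have h1 := wordLength_zpow_le hT (Multiplicative.ofAdd 1) g.toAdd
      rw [← hzpow g] at h1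
      have h2 : (wordLength T g : ℝ) ≤ (g.toAdd.natAbs : ℝ) * A := by
        rw [hA]
        exact_mod_cast h1
      rw [Nat.cast_natAbs, Int.cast_abs] at h2
      have := abs_nonneg (g.toAdd : ℝ)
      linarith
    have habs : ∀ n, walkMean (fun g ω => g * intStep ω) n
        (fun g : Multiplicative ℤ => |(g.toAdd : ℝ)|) 1 =
        walkMean (Trace.step (σ := Unit)) n (fun h => |(h.pos : ℝ)|) Trace.start := by
      intro n
      refine (walkMean_map (step' := fun (g : Multiplicative ℤ) ω => g * intStep ω)
        (π := fun h : Trace => Multiplicative.ofAdd h.pos) ?_ n (fun g => |(g.toAdd : ℝ)|)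
        Trace.start).symm
      rintro h (_ | ⟨ε, _, _⟩) <;> simp [intStep, Trace.step, Trace.go]
    obtain ⟨c, hc, hlow⟩ := Trace.exists_le_mean_abs_pos
    refine ⟨K⁻¹ * c, (A + 1) * (5 / 2), by positivity, by positivity, fun n => ?_⟩
    rw [drift_uniformOfFinset intStep hinj hne hR]
    rcases n.eq_zero_or_pos with rfl | hn
    · simp [walkMean_zero, wordLength_one]
    have h1 := walkMean_mono (step := fun g ω => g * intStep ω) n hl 1
    have h2 := walkMean_mono (step := fun g ω => g * intStep ω) n hu 1
    rw [walkMean_const_mul, habs] at h1 h2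
    rw [← Real.sqrt_eq_rpow]
    constructor
    · rw [mul_assoc, inv_mul_le_iff₀ hK]
      exact (hlow n hn).trans h1
    · refine h2.trans ?_
      rw [mul_assoc]
      exact mul_le_mul_of_nonneg_left (Trace.mean_abs_pos_le hn) (by positivity)

theorem hasPowerDrift_iterWreath (k : ℕ) :
    HasPowerDrift (iterWreath k) (1 - 1 / (2 : ℝ) ^ (k + 1)) := by
  induction k with
  | zero =>
    have h := hasPowerDrift_int
    norm_num at h ⊢
    exact h
  | succ k ih =>
    have h2 : (1 : ℝ) < 2 ^ (k + 1) := one_lt_pow₀ (by norm_num) (by omega)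
    have h3 : 1 / (2 : ℝ) ^ (k + 1) < 1 := (div_lt_one (by positivity)).mpr h2
    have h4 : 0 < 1 / (2 : ℝ) ^ (k + 1) := by positivity
    have h := ih.wreath (by linarith) (by linarith)
    have e : (1 + (1 - 1 / (2 : ℝ) ^ (k + 1))) / 2 = 1 - 1 / (2 : ℝ) ^ (k + 1 + 1) := by
      rw [pow_succ _ (k + 1)]
      field_simp
      ring
    rw [e] at h
    exact h

theorem theorem1 (k : ℕ) :
    ∃ μ : PMF (iterWreath k), IsSimpleWalk μ ∧
      ∀ T : Finset (iterWreath k), Subgroup.closure (T : Set (iterWreath k)) = ⊤ →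
        ∃ c C : ℝ, 0 < c ∧ 0 < C ∧ ∀ n : ℕ,
          c * (n : ℝ) ^ (1 - 1 / (2 : ℝ) ^ (k + 1)) ≤ drift T μ n ∧
            drift T μ n ≤ C * (n : ℝ) ^ (1 - 1 / (2 : ℝ) ^ (k + 1)) := by
  obtain ⟨S, hS, -, hinv, hgen, h⟩ := hasPowerDrift_iterWreath k
  exact ⟨PMF.uniformOfFinset S hS, ⟨S, hS, hinv, hgen, rfl⟩, h⟩
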